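/- Let $G$ be a finite directed graph with vertex set $V(G)$ and edge set $E(G)$ (loops and multiple edges are allowed). A directed cycle of $G$ is a sequence $v_0,x_0,v_1,x_1,\dots,v_n,x_n,v_0$ ($n\ge 0$) with $v_0,\dots,v_n$ pairwise distinct vertices and each $x_i$ an edge from $v_i$ to $v_{i+1}$ (where $v_{n+1}=v_0$), considered up to circular permutation. Let $\alpha(G)$ be the maximal number of pairwise edge-disjoint directed cycles in $G$, and $\tilde\alpha(G)$ the maximal number of pairwise vertex-disjoint directed cycles in $G$. For $v\in V(G)$ let $x_1,\dots,x_m$ be the edges with initial vertex $v$ and $y_1,\dots,y_n$ the edges with terminal vertex $v$, and let $e_l$ denote the $l$-th elementary symmetric polynomial ($e_l=0$ when $l$ exceeds the number of variables). Let $I(G)\subset\mathbb{Z}[E(G)]$ be the ideal generated by all $e_l(x_1,\dots,x_m)-e_l(y_1,\dots,y_n)$ with $v\in V(G)$ and $1\le l\le\max\{m,n\}$, and let $\tilde I(G)\subset\mathbb{Z}[E(G)]$ be the ideal generated by all $e_1(x_1,\dots,x_m)-e_1(y_1,\dots,y_n)$, all $e_l(x_1,\dots,x_m)$ with $2\le l\le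 m$, and all $e_l(y_1,\dots,y_n)$ with $2\le l\le n$, for $v\in V(G)$. Let $P(G)$ and $\tilde P(G)$ be the zero loci in $\mathbb{CP}^{|E(G)|-1}$ of the homogeneous ideals $I(G)$ and $\tilde I(G)$. A projective variety is a projective algebraic set that is not the union of two projective algebraic sets both different from it; with this convention the empty set is a projective variety, and it is also counted as a linear subspace (of dimension $-1$). Then: 1. The following are equivalent: (a) $P(G)$ is a projective variety; (b) $P(G)$ is a linear subspace of $\mathbb{CP}^{|E(G)|-1}$; (c) $G$ contains exactly $\alpha(G)$ distinct directed cycles. 2. The following are equivalent: (a) $\tilde P(G)$ is a projective variety; (b) $\tilde P(G)$ is a linear subspace of $\mathbb{CP}^{|E(G)|-1}$; (c) $G$ contains exactly $\tilde\alpha(G)$ distinct directed cycles. 3. If $\tilde P(G)$ is a projective variety, then $P(G)=\tilde P(G)$. -/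

import Mathlib

open scoped LinearAlgebra.Projectivization

/-- A directed graph with vertex set `V` and edge set `E`; loops and multiple edges are allowed. -/
structure DiMultigraph (V E : Type*) where
  /-- initial vertex of an edge -/
  src : E → V
  /-- terminal vertex of an edge -/
  tgt : E → V

/-! ### Projective algebraic sets in complex projective space with coordinates indexed by `E` -/

/-- The points of projective space at which all polynomials in `S` vanish, where a polynomial
vanishes at a point if it vanishes at every nonzero vector representing that point. -/
def projZeroLocus {E R : Type*} [CommRing R] [Algebra R ℂ] (S : Set (MvPolynomial E R)) :
    Set (ℙ ℂ (E → ℂ)) :=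
  {p | ∀ f ∈ S, ∀ (w : E → ℂ) (hw : w ≠ 0),
    Projectivization.mk ℂ w hw = p → MvPolynomial.aeval w f = 0}

/-- A projective algebraic set: the zero locus of a set of homogeneous complex polynomials. -/
def IsProjAlgebraicSet {E : Type*} (Z : Set (ℙ ℂ (E → ℂ))) : Prop :=
  ∃ S : Set (MvPolynomial E ℂ), (∀ f ∈ S, ∃ d : ℕ, f.IsHomogeneous d) ∧ Z = projZeroLocus S

/-- A projective variety: an irreducible projective algebraic set, i.e. one that is not the union
of two projective algebraic sets both different from it. (The empty set counts as irreducible.) -/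
def IsProjVariety {E : Type*} (Z : Set (ℙ ℂ (E → ℂ))) : Prop :=
  IsProjAlgebraicSet Z ∧
    ∀ Z₁ Z₂ : Set (ℙ ℂ (E → ℂ)), IsProjAlgebraicSet Z₁ → IsProjAlgebraicSet Z₂ →
      Z = Z₁ ∪ Z₂ → Z = Z₁ ∨ Z = Z₂

/-- A linear subspace of projective space (the empty set is the one of dimension `-1`). -/
def IsProjLinearSubspace {E : Type*} (Z : Set (ℙ ℂ (E → ℂ))) : Prop :=
  ∃ W : Projectivization.Subspace ℂ (E → ℂ), (W : Set (ℙ ℂ (E → ℂ))) = Z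

namespace DiMultigraph

variable {V E : Type*}

/-! ### Directed cycles -/

/-- A directed cycle `v₀, x₀, v₁, x₁, …, vₙ, xₙ, v₀`, recorded by its edges `x₀, …, xₙ` up to
circular permutation (`vᵢ` is the initial vertex of `xᵢ`): there is at least one edge, the terminal
vertex of each edge is the initial vertex of the cyclically next one, and `v₀, …, vₙ` are
pairwise distinct. -/
def IsDirectedCycle (G : DiMultigraph V E) (c : Cycle E) : Prop :=
  c ≠ Cycle.nil ∧ c.Chain (fun x y => G.tgt x = G.src y) ∧ (c.map G.src).Nodup

/-- The set of all directed cycles of `G`. -/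
def directedCycles (G : DiMultigraph V E) : Set (Cycle E) := {c | G.IsDirectedCycle c}

/-- No common edges. -/
def EdgeDisjoint (c d : Cycle E) : Prop := ∀ x, x ∈ c → x ∉ d

/-- No common vertices. -/
def VertexDisjoint (G : DiMultigraph V E) (c d : Cycle E) : Prop :=
  ∀ v, v ∈ c.map G.src → v ∉ d.map G.src

/-- The numbers of cycles in collections of pairwise edge-disjoint directed cycles. -/
def edgePackingSizes (G : DiMultigraph V E) : Set ℕ :=
  {n | ∃ C : Finset (Cycle E), (∀ c ∈ C, G.IsDirectedCycle c) ∧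
    (C : Set (Cycle E)).Pairwise EdgeDisjoint ∧ C.card = n}

/-- The numbers of cycles in collections of pairwise (vertex-)disjoint directed cycles. -/
def vertexPackingSizes (G : DiMultigraph V E) : Set ℕ :=
  {n | ∃ C : Finset (Cycle E), (∀ c ∈ C, G.IsDirectedCycle c) ∧
    (C : Set (Cycle E)).Pairwise G.VertexDisjoint ∧ C.card = n}

/-- The cycle packing number `α(G)`. -/
noncomputable def alpha (G : DiMultigraph V E) : ℕ := sSup G.edgePackingSizes

/-- The strong cycle packing number `α̃(G)`. -/
noncomputable def strongAlpha (G : DiMultigraph V E) : ℕ := sSup G.vertexPackingSizes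

theorem finite_directedCycles [Finite E] (G : DiMultigraph V E) : G.directedCycles.Finite := by
  classical
  have := Fintype.ofFinite E
  have hfin : {c : Cycle E | c.Nodup}.Finite :=
    Set.finite_coe_iff.mp (inferInstanceAs (Finite {c : Cycle E // c.Nodup}))
  refine hfin.subset ?_
  rintro c ⟨-, -, h⟩
  induction c using Quotient.inductionOn with
  | h l => exact List.Nodup.of_map G.src h

/-- `α(G)` is attained and is the maximum. -/
theorem isGreatest_alpha [Finite E] (G : DiMultigraph V E) :
    IsGreatest G.edgePackingSizes G.alpha := by
  have hb : BddAbove G.edgePackingSizes := by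
    refine ⟨G.directedCycles.ncard, ?_⟩
    rintro n ⟨C, hC, -, rfl⟩
    rw [← Set.ncard_coe_finset]
    exact Set.ncard_le_ncard hC G.finite_directedCycles
  exact ⟨Nat.sSup_mem ⟨0, ∅, by simp⟩ hb, fun n hn => le_csSup hb hn⟩

/-- `α̃(G)` is attained and is the maximum. -/
theorem isGreatest_strongAlpha [Finite E] (G : DiMultigraph V E) :
    IsGreatest G.vertexPackingSizes G.strongAlpha := by
  have hb : BddAbove G.vertexPackingSizes := by
    refine ⟨G.directedCycles.ncard, ?_⟩
    rintro n ⟨C, hC, -, rfl⟩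
    rw [← Set.ncard_coe_finset]
    exact Set.ncard_le_ncard hC G.finite_directedCycles
  exact ⟨Nat.sSup_mem ⟨0, ∅, by simp⟩ hb, fun n hn => le_csSup hb hn⟩

/-! ### Incidence ideals and incidence sets -/

section Incidence

variable [Fintype E]

open Classical in
/-- The edges having `v` as their initial vertex. -/
noncomputable def outEdges (G : DiMultigraph V E) (v : V) : Finset E :=
  Finset.univ.filter (fun x => G.src x = v)

open Classical in
/-- The edges having `v` as their terminal vertex. -/
noncomputable def inEdges (G : DiMultigraph V E) (v : V) : Finset E :=
  Finset.univ.filter (fun x => G.tgt x = v)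

/-- The `l`-th elementary symmetric polynomial in the variables belonging to the edges in `A`. -/
noncomputable def edgeESymm (A : Finset E) (l : ℕ) : MvPolynomial E ℤ :=
  (A.val.map (MvPolynomial.X : E → MvPolynomial E ℤ)).esymm l

/-- The incidence ideal `I(G)`. -/
noncomputable def incidenceIdeal (G : DiMultigraph V E) : Ideal (MvPolynomial E ℤ) :=
  Ideal.span {f | ∃ (v : V) (l : ℕ), 1 ≤ l ∧ l ≤ max (G.outEdges v).card (G.inEdges v).card ∧
    f = edgeESymm (G.outEdges v) l - edgeESymm (G.inEdges v) l}

/-- The strong incidence ideal. -/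
noncomputable def strongIncidenceIdeal (G : DiMultigraph V E) : Ideal (MvPolynomial E ℤ) :=
  Ideal.span
    ({f | ∃ v : V, f = edgeESymm (G.outEdges v) 1 - edgeESymm (G.inEdges v) 1} ∪
     {f | ∃ (v : V) (l : ℕ), 2 ≤ l ∧ l ≤ (G.outEdges v).card ∧ f = edgeESymm (G.outEdges v) l} ∪
     {f | ∃ (v : V) (l : ℕ), 2 ≤ l ∧ l ≤ (G.inEdges v).card ∧ f = edgeESymm (G.inEdges v) l})

/-- The incidence set `P(G)`. -/
def incidenceSet (G : DiMultigraph V E) : Set (ℙ ℂ (E → ℂ)) :=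
  projZeroLocus (G.incidenceIdeal : Set (MvPolynomial E ℤ))

/-- The strong incidence set `P̃(G)`. -/
def strongIncidenceSet (G : DiMultigraph V E) : Set (ℙ ℂ (E → ℂ)) :=
  projZeroLocus (G.strongIncidenceIdeal : Set (MvPolynomial E ℤ))

end Incidence

end DiMultigraph

/-! ### Projective algebraic sets -/

section Projective

variable {E : Type*}

/-! Equality of all elementary symmetric functions of the labels leaving and entering a vertex means
that ∏(1 + aX) agrees on both sides, i.e. the nonzero labels agree as multisets
(`Multiset.filter_ne_zero_eq_iff_esymm`). In such a balanced labelling one can follow a fixed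
nonzero label until a directed cycle closes. Zeroing that cycle preserves balance, so induction on
the support makes the labelling a combination of indicators of edge-disjoint cycles, and conversely
(`balanced_iff_exists_packing`). The strong ideal also allows at most one nonzero label on each side
of a vertex, which makes the cycles vertex-disjoint.

Hence P(G) and P̃(G) are finite unions of linear subspaces, one for each packing (`IsPackingUnion`).
If the union is irreducible, it is the span of a single packing; this span contains the indicator of
every cycle, which forces every cycle into the packing. So all cycles are pairwise disjoint, which
is the counting condition. Conversely, if all are disjoint, the union is the span of all cycles, and
linear subspaces are irreducible. For the last claim, vertex-disjointness implies edge-disjointness,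
so both sets equal this same span. -/

theorem MvPolynomial.IsHomogeneous.aeval_smul {f : MvPolynomial E ℂ} {d : ℕ}
    (hf : f.IsHomogeneous d) (a : ℂ) (w : E → ℂ) :
    MvPolynomial.aeval (a • w) f = a ^ d * MvPolynomial.aeval w f := by
  rw [MvPolynomial.aeval_def, MvPolynomial.aeval_def, MvPolynomial.eval₂_eq, MvPolynomial.eval₂_eq,
    Finset.mul_sum]
  refine Finset.sum_congr rfl fun s hs => ?_
  have hd : ∑ i ∈ s.support, s i = d := (hf.degree_eq_sum_deg_support hs).symm
  simp only [Pi.smul_apply, smul_eq_mul, mul_pow, Finset.prod_mul_distrib, Finset.prod_pow_eq_pow_sum,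
    hd]
  ring

theorem mk_mem_projZeroLocus {S : Set (MvPolynomial E ℂ)}
    (hS : ∀ f ∈ S, ∃ d : ℕ, f.IsHomogeneous d) {w : E → ℂ} (hw : w ≠ 0) :
    Projectivization.mk ℂ w hw ∈ projZeroLocus S ↔ ∀ f ∈ S, MvPolynomial.aeval w f = 0 := by
  refine ⟨fun h f hf => h f hf w hw rfl, fun h f hf u hu e => ?_⟩
  obtain ⟨a, rfl⟩ := (Projectivization.mk_eq_mk_iff' ℂ _ _ hu hw).1 e
  obtain ⟨d, hd⟩ := hS f hf
  rw [hd.aeval_smul, h f hf, mul_zero]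

theorem isProjAlgebraicSet_empty : IsProjAlgebraicSet (∅ : Set (ℙ ℂ (E → ℂ))) := by
  refine ⟨{1}, fun f hf => ⟨0, hf ▸ MvPolynomial.isHomogeneous_one E ℂ⟩, ?_⟩
  symm
  rw [Set.eq_empty_iff_forall_notMem]
  refine Projectivization.ind fun w hw h => ?_
  simpa using h 1 rfl w hw rfl

theorem IsProjAlgebraicSet.union {Z₁ Z₂ : Set (ℙ ℂ (E → ℂ))} (h₁ : IsProjAlgebraicSet Z₁)
    (h₂ : IsProjAlgebraicSet Z₂) : IsProjAlgebraicSet (Z₁ ∪ Z₂) := by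
  obtain ⟨S, hS, rfl⟩ := h₁
  obtain ⟨T, hT, rfl⟩ := h₂
  have hST : ∀ f ∈ Set.image2 (· * ·) S T, ∃ d : ℕ, f.IsHomogeneous d := by
    rintro _ ⟨f, hf, g, hg, rfl⟩
    obtain ⟨d, hd⟩ := hS f hf
    obtain ⟨e, he⟩ := hT g hg
    exact ⟨d + e, hd.mul he⟩
  refine ⟨_, hST, ?_⟩
  ext p
  induction p using Projectivization.ind with | h w hw
  rw [Set.mem_union, mk_mem_projZeroLocus hS, mk_mem_projZeroLocus hT, mk_mem_projZeroLocus hST]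
  constructor
  · rintro (h | h) _ ⟨f, hf, g, hg, rfl⟩
    · rw [map_mul, h f hf, zero_mul]
    · rw [map_mul, h g hg, mul_zero]
  · intro h
    by_contra! hc
    obtain ⟨⟨f, hf, hf0⟩, g, hg, hg0⟩ := hc
    have := h _ ⟨f, hf, g, hg, rfl⟩
    rw [map_mul] at this
    exact (mul_ne_zero hf0 hg0) this

theorem IsProjAlgebraicSet.biUnion {ι : Type*} (s : Finset ι) {Z : ι → Set (ℙ ℂ (E → ℂ))}
    (h : ∀ i ∈ s, IsProjAlgebraicSet (Z i)) : IsProjAlgebraicSet (⋃ i ∈ s, Z i) := by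
  classical
  induction s using Finset.induction_on with
  | empty => simpa using isProjAlgebraicSet_empty
  | insert i s _ ih =>
    rw [Finset.set_biUnion_insert]
    exact (h i (by simp)).union (ih fun j hj => h j (by simp [hj]))

theorem IsProjVariety.exists_eq_of_eq_biUnion {ι : Type*} (s : Finset ι) {Z : Set (ℙ ℂ (E → ℂ))}
    (hZ : IsProjVariety Z) {Y : ι → Set (ℙ ℂ (E → ℂ))} (hY : ∀ i ∈ s, IsProjAlgebraicSet (Y i))
    (h : Z = ⋃ i ∈ s, Y i) (hs : s.Nonempty) : ∃ i ∈ s, Z = Y i := by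
  classical
  induction hs using Finset.Nonempty.cons_induction with
  | singleton i => exact ⟨i, by simp, by simpa using h⟩
  | cons i s hi hs ih =>
    rw [Finset.cons_eq_insert, Finset.set_biUnion_insert] at h
    rcases hZ.2 _ _ (hY i (by simp)) (IsProjAlgebraicSet.biUnion s fun j hj => hY j (by simp [hj])) h
      with h | h
    · exact ⟨i, by simp, h⟩
    · obtain ⟨j, hj, e⟩ := ih (fun j hj => hY j (by simp [hj])) h
      exact ⟨j, by simp [hj], e⟩

/-- A subspace is the common kernel of the functionals vanishing on it, and each functional is a
linear form. -/
theorem isProjAlgebraicSet_projectivization [Finite E] (W : Submodule ℂ (E → ℂ)) :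
    IsProjAlgebraicSet (W.projectivization : Set (ℙ ℂ (E → ℂ))) := by
  classical
  have := Fintype.ofFinite E
  let lin : Module.Dual ℂ (E → ℂ) → MvPolynomial E ℂ := fun φ =>
    ∑ i, MvPolynomial.C (φ (Pi.single i 1)) * MvPolynomial.X i
  have hlin : ∀ φ w, MvPolynomial.aeval w (lin φ) = φ w := by
    intro φ w
    conv_rhs => rw [pi_eq_sum_univ' w, map_sum]
    simp only [lin, map_sum, map_mul, MvPolynomial.aeval_X, MvPolynomial.algHom_C, map_smul,
      smul_eq_mul, Algebra.algebraMap_self, RingHom.id_apply]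
    refine Finset.sum_congr rfl fun i _ => ?_
    rw [mul_comm]
  have hS : ∀ f ∈ lin '' {φ | W ≤ LinearMap.ker φ}, ∃ d : ℕ, f.IsHomogeneous d := by
    rintro _ ⟨φ, -, rfl⟩
    exact ⟨1, MvPolynomial.IsHomogeneous.sum _ _ _ fun i _ =>
      (MvPolynomial.isHomogeneous_X ℂ i).C_mul _⟩
  refine ⟨_, hS, ?_⟩
  ext p
  induction p using Projectivization.ind with | h w hw
  rw [mk_mem_projZeroLocus hS, SetLike.mem_coe, Submodule.mk_mem_projectivization_iff]
  constructor
  · rintro h _ ⟨φ, hφ, rfl⟩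
    rw [hlin]
    exact hφ h
  · intro h
    by_contra hw
    obtain ⟨φ, hφ, hW⟩ := Submodule.exists_le_ker_of_notMem hw
    exact hφ (hlin φ w ▸ h _ ⟨φ, hW, rfl⟩)

/-- The restriction of a polynomial to the affine line through `u` and `v`. -/
theorem MvPolynomial.exists_restrict_line (f : MvPolynomial E ℂ) (u v : E → ℂ) :
    ∃ p : Polynomial ℂ, ∀ t : ℂ, p.eval t = MvPolynomial.aeval ((1 - t) • u + t • v) f := by
  refine ⟨MvPolynomial.aeval (fun i => (1 - Polynomial.X) * Polynomial.C (u i) +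
    Polynomial.X * Polynomial.C (v i)) f, fun t => ?_⟩
  induction f using MvPolynomial.induction_on with
  | C a => simp
  | add p q hp hq => rw [map_add, map_add, Polynomial.eval_add, hp, hq]
  | mul_X p i hp =>
    rw [map_mul, map_mul, Polynomial.eval_mul, hp]
    simp [mul_comm t]

/-- If both pieces were proper, some f and g defining them would be nonzero at points u, v of W. On
the line through u and v both restrict to nonzero polynomials in one variable, so some point of W
avoids both pieces. -/
theorem isProjVariety_projectivization [Finite E] (W : Submodule ℂ (E → ℂ)) :
    IsProjVariety (W.projectivization : Set (ℙ ℂ (E → ℂ))) := by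
  refine ⟨isProjAlgebraicSet_projectivization W, fun Z₁ Z₂ h₁ h₂ h => ?_⟩
  obtain ⟨S, hS, rfl⟩ := h₁
  obtain ⟨T, hT, rfl⟩ := h₂
  by_contra! hc
  have key : ∀ {S' : Set (MvPolynomial E ℂ)}, (∀ f ∈ S', ∃ d : ℕ, f.IsHomogeneous d) →
      projZeroLocus S' ⊆ (W.projectivization : Set (ℙ ℂ (E → ℂ))) →
      (W.projectivization : Set (ℙ ℂ (E → ℂ))) ≠ projZeroLocus S' →
      ∃ u ∈ W, u ≠ 0 ∧ ∃ f ∈ S', MvPolynomial.aeval u f ≠ 0 := by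
    intro S' hS' hsub hne
    by_contra! hall
    refine hne (Set.Subset.antisymm (fun p hp => ?_) hsub)
    induction p using Projectivization.ind with | h w hw
    exact (mk_mem_projZeroLocus hS' hw).2 (hall w hp hw)
  obtain ⟨u, huW, hu, f, hf, hfu⟩ := key hS (h ▸ Set.subset_union_left) hc.1
  obtain ⟨v, hvW, hv, g, hg, hgv⟩ := key hT (h ▸ Set.subset_union_right) hc.2
  obtain ⟨i, hi⟩ := Function.ne_iff.1 hu
  obtain ⟨p, hp⟩ := f.exists_restrict_line u v
  obtain ⟨q, hq⟩ := g.exists_restrict_line u v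
  -- A coordinate with `u i ≠ 0` is the third polynomial to avoid: it keeps the chosen point of the
  -- line away from the origin.
  obtain ⟨r, hr⟩ := (MvPolynomial.X i : MvPolynomial E ℂ).exists_restrict_line u v
  have hp0 : p ≠ 0 := by
    rintro rfl
    apply hfu
    simpa using (hp 0).symm
  have hq0 : q ≠ 0 := by
    rintro rfl
    apply hgv
    simpa using (hq 1).symm
  have hr0 : r ≠ 0 := by
    rintro rfl
    apply hi
    simpa using (hr 0).symm
  obtain ⟨t, ht⟩ : ∃ t, (p * q * r).eval t ≠ 0 := by
    by_contra! hall
    exact mul_ne_zero (mul_ne_zero hp0 hq0) hr0 (Polynomial.funext (by simpa using hall))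
  simp only [Polynomial.eval_mul, ne_eq, mul_eq_zero, not_or, hp, hq, hr] at ht
  set w := (1 - t) • u + t • v
  have hw : w ≠ 0 := fun h0 => ht.2 (by simp [h0])
  have hwW : Projectivization.mk ℂ w hw ∈ (W.projectivization : Set (ℙ ℂ (E → ℂ))) :=
    (W.mk_mem_projectivization_iff hw).2 (W.add_mem (W.smul_mem _ huW) (W.smul_mem _ hvW))
  rw [h] at hwW
  rcases hwW with hw' | hw'
  · exact ht.1.1 ((mk_mem_projZeroLocus hS hw).1 hw' f hf)
  · exact ht.1.2 ((mk_mem_projZeroLocus hT hw).1 hw' g hg)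

theorem IsProjLinearSubspace.isProjVariety [Finite E] {Z : Set (ℙ ℂ (E → ℂ))}
    (hZ : IsProjLinearSubspace Z) : IsProjVariety Z := by
  obtain ⟨W, rfl⟩ := hZ
  simpa using isProjVariety_projectivization (Projectivization.Subspace.submodule W)

end Projective

/-! ### Elementary symmetric functions and the nonzero part of a multiset -/

namespace Multiset

open Polynomial

theorem esymm_cons_succ {R : Type*} [CommSemiring R] (a : R) (s : Multiset R) (n : ℕ) :
    (a ::ₘ s).esymm (n + 1) = s.esymm (n + 1) + a * s.esymm n := by
  simp [esymm, powersetCard_cons, sum_map_mul_left]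

theorem esymm_zero_right {R : Type*} [CommSemiring R] (s : Multiset R) : s.esymm 0 = 1 := by
  simp [esymm]

theorem esymm_eq_zero_of_card_lt {R : Type*} [CommSemiring R] {s : Multiset R} {n : ℕ}
    (h : card s < n) : s.esymm n = 0 := by
  simp [esymm, powersetCard_eq_empty n h]

/-- The generating polynomial of the elementary symmetric functions. -/
noncomputable def esymmPoly (s : Multiset ℂ) : ℂ[X] := (s.map fun a => 1 + C a * X).prod

theorem coeff_esymmPoly (s : Multiset ℂ) (n : ℕ) : s.esymmPoly.coeff n = s.esymm n := by
  induction s using Multiset.induction_on generalizing n with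
  | empty =>
    cases n with
    | zero => simp [esymmPoly, esymm_zero_right]
    | succ n => rw [esymm_eq_zero_of_card_lt (by simp)]; simp [esymmPoly, coeff_one]
  | cons a s ih =>
    have : (a ::ₘ s).esymmPoly = s.esymmPoly + C a * (X * s.esymmPoly) := by
      simp [esymmPoly]; ring
    rw [this, coeff_add, coeff_C_mul]
    cases n with
    | zero => simp [ih, esymm_zero_right]
    | succ n => rw [coeff_X_mul, ih, ih, esymm_cons_succ]

theorem esymmPoly_ne_zero (s : Multiset ℂ) : s.esymmPoly ≠ 0 := by
  intro h
  simpa [h, esymm_zero_right] using coeff_esymmPoly s 0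

theorem esymmPoly_filter_ne_zero (s : Multiset ℂ) : (s.filter (· ≠ 0)).esymmPoly = s.esymmPoly := by
  induction s using Multiset.induction_on with
  | empty => simp
  | cons a s ih =>
    by_cases ha : a = 0
    · subst ha
      rw [filter_cons_of_neg _ (p := (· ≠ 0)) (not_not.2 rfl), ih]
      simp [esymmPoly]
    · rw [filter_cons_of_pos _ (p := (· ≠ 0)) ha]
      simpa [esymmPoly] using Or.inl ih

/-- Zero entries contribute the factor 1 and leave no trace; a nonzero entry a contributes the root
-1/a, from which it is recovered. -/
theorem roots_esymmPoly (s : Multiset ℂ) :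
    s.esymmPoly.roots = (s.filter (· ≠ 0)).map fun a => -a⁻¹ := by
  induction s using Multiset.induction_on with
  | empty => simp [esymmPoly]
  | cons a s ih =>
    have h : (a ::ₘ s).esymmPoly = (1 + C a * X) * s.esymmPoly := by simp [esymmPoly]
    have h0 := (a ::ₘ s).esymmPoly_ne_zero
    rw [h] at h0 ⊢
    rw [roots_mul h0, ih]
    by_cases ha : a = 0
    · subst ha
      simp
    · have : (1 + C a * X : ℂ[X]) = C a * (X - C (-a⁻¹)) := by
        rw [mul_sub, ← C_mul, mul_neg, mul_inv_cancel₀ ha, C_neg, C_1]; ring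
      rw [this, roots_C_mul _ ha, roots_X_sub_C, filter_cons_of_pos _ (p := (· ≠ 0)) ha, map_cons]
      rfl

theorem filter_ne_zero_eq_iff_esymm {s t : Multiset ℂ} :
    s.filter (· ≠ 0) = t.filter (· ≠ 0) ↔ ∀ n, s.esymm n = t.esymm n := by
  constructor
  · intro h n
    rw [← coeff_esymmPoly, ← coeff_esymmPoly, ← esymmPoly_filter_ne_zero s, h,
      esymmPoly_filter_ne_zero]
  · intro h
    have : s.esymmPoly = t.esymmPoly := by
      ext n
      rw [coeff_esymmPoly, coeff_esymmPoly, h]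
    have h2 := s.roots_esymmPoly
    rw [this, roots_esymmPoly] at h2
    exact (map_injective (fun a b hab => inv_injective (neg_injective hab)) h2).symm

theorem filter_ne_zero_eq_iff_esymm_of_le_max {s t : Multiset ℂ} :
    s.filter (· ≠ 0) = t.filter (· ≠ 0) ↔
      ∀ n, 1 ≤ n → n ≤ max (card s) (card t) → s.esymm n = t.esymm n := by
  rw [filter_ne_zero_eq_iff_esymm]
  refine ⟨fun h n _ _ => h n, fun h n => ?_⟩
  rcases Nat.eq_zero_or_pos n with rfl | hn
  · simp [esymm_zero_right]
  rcases le_or_gt n (max (card s) (card t)) with h' | h'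
  · exact h n hn h'
  · rw [max_lt_iff] at h'
    rw [esymm_eq_zero_of_card_lt h'.1, esymm_eq_zero_of_card_lt h'.2]

theorem card_filter_ne_zero_le_one_iff {s : Multiset ℂ} :
    card (s.filter (· ≠ 0)) ≤ 1 ↔ ∀ n, 2 ≤ n → n ≤ card s → s.esymm n = 0 := by
  constructor
  · intro h n hn _
    rw [← coeff_esymmPoly, ← esymmPoly_filter_ne_zero, coeff_esymmPoly]
    exact esymm_eq_zero_of_card_lt (by omega)
  · intro h
    have hdeg : s.esymmPoly.natDegree ≤ 1 := by
      rw [natDegree_le_iff_coeff_eq_zero]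
      intro n hn
      rw [coeff_esymmPoly]
      rcases le_or_gt n (card s) with h' | h'
      · exact h n hn h'
      · exact esymm_eq_zero_of_card_lt h'
    have := (card_roots' s.esymmPoly).trans hdeg
    rwa [roots_esymmPoly, card_map] at this

/-- Once each side has at most one nonzero entry, all its higher symmetric functions vanish and
`esymm 1` determines the rest. -/
theorem strong_iff_esymm {s t : Multiset ℂ} :
    (s.filter (· ≠ 0) = t.filter (· ≠ 0) ∧ card (s.filter (· ≠ 0)) ≤ 1) ↔
      s.esymm 1 = t.esymm 1 ∧ (∀ n, 2 ≤ n → n ≤ card s → s.esymm n = 0) ∧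
        ∀ n, 2 ≤ n → n ≤ card t → t.esymm n = 0 := by
  rw [← card_filter_ne_zero_le_one_iff, ← card_filter_ne_zero_le_one_iff]
  constructor
  · rintro ⟨h, hc⟩
    exact ⟨filter_ne_zero_eq_iff_esymm.1 h 1, hc, h ▸ hc⟩
  · rintro ⟨h, hs, ht⟩
    refine ⟨filter_ne_zero_eq_iff_esymm.2 fun n => ?_, hs⟩
    rcases n with _ | _ | n
    · simp [esymm_zero_right]
    · exact h
    · rw [← coeff_esymmPoly, ← coeff_esymmPoly, ← esymmPoly_filter_ne_zero,
        ← esymmPoly_filter_ne_zero t, coeff_esymmPoly, coeff_esymmPoly,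
        esymm_eq_zero_of_card_lt (by omega), esymm_eq_zero_of_card_lt (by omega)]

end Multiset

namespace DiMultigraph

variable {V E : Type*} {G : DiMultigraph V E}

/-! ### Directed cycles as lists of edges -/

theorem _root_.Cycle.exists_eq_coe_cons_of_mem {α : Type*} {c : Cycle α} {x : α} (hx : x ∈ c) :
    ∃ l : List α, c = ((x :: l : List α) : Cycle α) := by
  induction c using Quotient.inductionOn with
  | h l =>
    obtain ⟨s, t, rfl⟩ := List.append_of_mem (show x ∈ l from hx)
    exact ⟨t ++ s, Cycle.coe_eq_coe.2 List.isRotated_append⟩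

theorem _root_.Cycle.exists_mem_of_ne_nil {α : Type*} {c : Cycle α} (hc : c ≠ Cycle.nil) :
    ∃ x, x ∈ c := by
  induction c using Quotient.inductionOn with
  | h l =>
    cases l with
    | nil => exact absurd rfl hc
    | cons x l => exact ⟨x, List.mem_cons_self⟩

theorem isDirectedCycle_coe_cons {x : E} {l : List E} :
    G.IsDirectedCycle ((x :: l : List E) : Cycle E) ↔
      List.IsChain (fun x y => G.tgt x = G.src y) (x :: (l ++ [x])) ∧
        ((x :: l).map G.src).Nodup := by
  rw [IsDirectedCycle, Cycle.chain_coe_cons, Cycle.map_coe, Cycle.nodup_coe_iff]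
  simp

theorem IsDirectedCycle.nodup {c : Cycle E} (hc : G.IsDirectedCycle c) : c.Nodup := by
  obtain ⟨-, -, h⟩ := hc
  induction c using Quotient.inductionOn with
  | h l => exact List.Nodup.of_map G.src h

theorem IsDirectedCycle.src_injOn {c : Cycle E} (hc : G.IsDirectedCycle c) :
    Set.InjOn G.src {x | x ∈ c} := by
  obtain ⟨-, -, h⟩ := hc
  induction c using Quotient.inductionOn with
  | h l => exact fun x hx y hy => List.inj_on_of_nodup_map h hx hy

theorem map_tgt_of_isChain {x y : E} {l : List E}
    (h : List.IsChain (fun x y => G.tgt x = G.src y) (x :: (l ++ [y]))) :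
    (x :: l).map G.tgt = (l ++ [y]).map G.src := by
  induction l generalizing x with
  | nil => simpa using h
  | cons z l ih =>
    rw [List.cons_append, List.isChain_cons_cons] at h
    rw [List.map_cons, ih h.2, h.1]
    simp

theorem IsDirectedCycle.map_tgt_perm {c : Cycle E} (hc : G.IsDirectedCycle c) :
    c.toMultiset.map G.tgt = c.toMultiset.map G.src := by
  obtain ⟨x, hx⟩ := Cycle.exists_mem_of_ne_nil hc.1
  obtain ⟨l, rfl⟩ := Cycle.exists_eq_coe_cons_of_mem hx
  have := map_tgt_of_isChain (isDirectedCycle_coe_cons.1 hc).1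
  rw [Cycle.coe_toMultiset, Multiset.map_coe, Multiset.map_coe, this, Multiset.coe_eq_coe]
  exact (List.perm_append_singleton x l).map _

/-- Inside `P` the successor is unique, so both walks take the same steps; both stop at the first
visit to `x`. -/
theorem eq_of_isChain {r : E → E → Prop} {x : E} {P : E → Prop}
    (hr : ∀ a b b', P b → P b' → r a b → r a b' → b = b') {a : E} {l₁ l₂ : List E}
    (h₁ : List.IsChain r (a :: (l₁ ++ [x]))) (h₂ : List.IsChain r (a :: (l₂ ++ [x])))
    (hP₁ : ∀ y ∈ l₁, P y) (hP₂ : ∀ y ∈ l₂, P y) (hx : P x) (hx₁ : x ∉ l₁) (hx₂ : x ∉ l₂) :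
    l₁ = l₂ := by
  induction l₁ generalizing a l₂ with
  | nil =>
    cases l₂ with
    | nil => rfl
    | cons b l₂ =>
      simp only [List.nil_append, List.cons_append, List.isChain_cons_cons] at h₁ h₂
      exact absurd (hr a _ _ hx (hP₂ b (by simp)) h₁.1 h₂.1) (by simp at hx₂; tauto)
  | cons b l₁ ih =>
    cases l₂ with
    | nil =>
      simp only [List.nil_append, List.cons_append, List.isChain_cons_cons] at h₁ h₂
      exact absurd (hr a _ _ hx (hP₁ b (by simp)) h₂.1 h₁.1) (by simp at hx₁; tauto)
    | cons b' l₂ =>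
      simp only [List.cons_append, List.isChain_cons_cons] at h₁ h₂
      obtain rfl := hr a _ _ (hP₁ b (by simp)) (hP₂ b' (by simp)) h₁.1 h₂.1
      rw [ih h₁.2 h₂.2 (fun y hy => hP₁ y (by simp [hy])) (fun y hy => hP₂ y (by simp [hy]))
        (by simp at hx₁; tauto) (by simp at hx₂; tauto)]

/-- Within d an edge is determined by its initial vertex, so c, starting at a shared edge and
staying in d, must follow d until it returns. -/
theorem IsDirectedCycle.eq_of_subset {c d : Cycle E} (hc : G.IsDirectedCycle c)
    (hd : G.IsDirectedCycle d) (h : ∀ x ∈ c, x ∈ d) : c = d := by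
  obtain ⟨x, hx⟩ := Cycle.exists_mem_of_ne_nil hc.1
  have hinj := hd.src_injOn
  have hx' := h x hx
  obtain ⟨l, rfl⟩ := Cycle.exists_eq_coe_cons_of_mem hx
  obtain ⟨l', rfl⟩ := Cycle.exists_eq_coe_cons_of_mem hx'
  have h₁ := isDirectedCycle_coe_cons.1 hc
  have h₂ := isDirectedCycle_coe_cons.1 hd
  have n₁ := List.Nodup.of_map _ h₁.2
  have n₂ := List.Nodup.of_map _ h₂.2
  rw [eq_of_isChain (P := fun y => y ∈ ((x :: l' : List E) : Cycle E))
    (fun a b b' hb hb' hab hab' => hinj hb hb' (hab.symm.trans hab')) h₁.1 h₂.1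
    (fun y hy => h y (by simp [hy])) (fun y hy => Cycle.mem_coe_iff.2 (List.mem_cons_of_mem _ hy))
    (Cycle.mem_coe_iff.2 List.mem_cons_self) (List.nodup_cons.1 n₁).1 (List.nodup_cons.1 n₂).1]

/-- Choosing one edge of `A` at each initial vertex gives a self-map of a finite set of vertices,
which has a periodic point. Iterating on vertices rather than edges makes the vertices of the orbit
distinct. -/
theorem exists_isDirectedCycle_of_forall_exists [Finite E] {A : Set E} (hA : A.Nonempty)
    (h : ∀ x ∈ A, ∃ y ∈ A, G.tgt x = G.src y) :
    ∃ c, G.IsDirectedCycle c ∧ ∀ x ∈ c, x ∈ A := by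
  let S := G.src '' A
  have hg : ∀ v : S, ∃ x ∈ A, G.src x = v := fun v => v.2
  choose g hgA hgsrc using hg
  let f : S → S := fun v => ⟨G.tgt (g v), by
    obtain ⟨y, hy, e⟩ := h _ (hgA v)
    exact ⟨y, hy, e.symm⟩⟩
  have : Finite S := Set.Finite.to_subtype (Set.toFinite _)
  obtain ⟨x₀, hx₀⟩ := hA
  obtain ⟨v, hv⟩ : ∃ v, v ∈ Function.periodicPts f := by
    obtain ⟨m, n, hmn, e⟩ := Finite.exists_ne_map_eq_of_infinite
      (fun n : ℕ => f^[n] ⟨G.src x₀, x₀, hx₀, rfl⟩)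
    wlog hlt : m < n generalizing m n
    · exact this n m hmn.symm e.symm (by omega)
    refine ⟨f^[m] ⟨G.src x₀, x₀, hx₀, rfl⟩, n - m, by omega, ?_⟩
    rw [Function.IsPeriodicPt, Function.IsFixedPt, ← Function.iterate_add_apply,
      Nat.sub_add_cancel hlt.le]
    exact e.symm
  refine ⟨(Function.periodicOrbit f v).map g, ⟨?_, ?_, ?_⟩, ?_⟩
  · obtain ⟨y, hy⟩ : ∃ y, y ∈ (Function.periodicOrbit f v).map g :=
      ⟨g v, Cycle.mem_map.2 ⟨v, Function.self_mem_periodicOrbit hv, rfl⟩⟩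
    intro e
    rw [e] at hy
    exact Cycle.notMem_nil _ hy
  · rw [Cycle.chain_map, Function.periodicOrbit_chain' _ hv]
    intro n
    rw [Function.iterate_succ_apply', hgsrc]
  · have : ((Function.periodicOrbit f v).map g).map G.src =
        (Function.periodicOrbit f v).map Subtype.val := by
      induction Function.periodicOrbit f v using Quotient.inductionOn with
      | h l =>
        have e : (l.map g).map G.src = l.map Subtype.val := by
          rw [List.map_map]
          exact List.map_congr_left fun w _ => hgsrc w
        exact congrArg (fun l : List V => (l : Cycle V)) e
    rw [this]
    have hn := Function.nodup_periodicOrbit (f := f) (x := v)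
    induction h : Function.periodicOrbit f v using Quotient.inductionOn with
    | h l =>
      rw [h] at hn
      exact List.Nodup.map Subtype.val_injective hn
  · intro x hx
    obtain ⟨w, -, rfl⟩ := Cycle.mem_map.1 hx
    exact hgA w

end DiMultigraph

namespace DiMultigraph

variable {V E : Type*} {G : DiMultigraph V E}

/-! ### Balanced edge labellings -/

open Classical in
/-- The indicator vector of the edges of a cycle. -/
noncomputable def cycleVec (c : Cycle E) : E → ℂ := fun x => if x ∈ c then 1 else 0

theorem cycleVec_of_mem {c : Cycle E} {x : E} (h : x ∈ c) : cycleVec c x = 1 := if_pos h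

theorem cycleVec_of_notMem {c : Cycle E} {x : E} (h : x ∉ c) : cycleVec c x = 0 := if_neg h

theorem IsDirectedCycle.cycleVec_ne_zero {c : Cycle E} (hc : G.IsDirectedCycle c) :
    cycleVec c ≠ 0 := by
  obtain ⟨x, hx⟩ := Cycle.exists_mem_of_ne_nil hc.1
  intro h
  simpa [h] using cycleVec_of_mem hx

/-- The span of the indicator vectors of a set of cycles. -/
noncomputable def cycleSpan (C : Set (Cycle E)) : Submodule ℂ (E → ℂ) :=
  Submodule.span ℂ (cycleVec '' C)

theorem cycleVec_mem_cycleSpan {C : Set (Cycle E)} {c : Cycle E} (hc : c ∈ C) :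
    cycleVec c ∈ cycleSpan C := Submodule.subset_span ⟨c, hc, rfl⟩

theorem cycleSpan_mono {C D : Set (Cycle E)} (h : C ⊆ D) : cycleSpan C ≤ cycleSpan D :=
  Submodule.span_mono (Set.image_mono h)

theorem exists_mem_of_mem_cycleSpan {C : Set (Cycle E)} {w : E → ℂ} (hw : w ∈ cycleSpan C) {x : E}
    (hx : w x ≠ 0) : ∃ c ∈ C, x ∈ c := by
  by_contra! h
  apply hx
  induction hw using Submodule.span_induction with
  | mem w hw =>
    obtain ⟨c, hc, rfl⟩ := hw
    exact cycleVec_of_notMem (h c hc)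
  | zero => rfl
  | add u v _ _ hu hv =>
    by_contra hne
    by_cases h0 : u x = 0
    · by_cases h1 : v x = 0
      · exact hne (by simp [h0, h1])
      · exact h1 (hv h1)
    · exact h0 (hu h0)
  | smul a u _ hu =>
    by_contra hne
    by_cases h0 : u x = 0
    · exact hne (by simp [h0])
    · exact h0 (hu h0)

theorem eq_of_mem_cycleSpan {C : Set (Cycle E)} (hC : C.Pairwise EdgeDisjoint) {w : E → ℂ}
    (hw : w ∈ cycleSpan C) {c : Cycle E} (hc : c ∈ C) {x y : E} (hx : x ∈ c) (hy : y ∈ c) :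
    w x = w y := by
  induction hw using Submodule.span_induction with
  | mem w hw =>
    obtain ⟨d, hd, rfl⟩ := hw
    by_cases h : c = d
    · subst h
      rw [cycleVec_of_mem hx, cycleVec_of_mem hy]
    · rw [cycleVec_of_notMem (hC hc hd h x hx), cycleVec_of_notMem (hC hc hd h y hy)]
  | zero => rfl
  | add u v _ _ hu hv => simp [hu, hv]
  | smul a u _ hu => simp [hu]

theorem VertexDisjoint.edgeDisjoint {c d : Cycle E} (h : G.VertexDisjoint c d) :
    EdgeDisjoint c d := fun x hx hx' =>
  h (G.src x) (Cycle.mem_map.2 ⟨x, hx, rfl⟩) (Cycle.mem_map.2 ⟨x, hx', rfl⟩)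

variable [Fintype E]

@[simp] theorem mem_outEdges {v : V} {x : E} : x ∈ G.outEdges v ↔ G.src x = v := by
  simp [outEdges]

@[simp] theorem mem_inEdges {v : V} {x : E} : x ∈ G.inEdges v ↔ G.tgt x = v := by
  simp [inEdges]

/-- At each vertex, the nonzero labels of the outgoing edges agree with those of the incoming
edges. -/
def Balanced (G : DiMultigraph V E) (w : E → ℂ) : Prop :=
  ∀ v, ((G.outEdges v).val.map w).filter (· ≠ 0) = ((G.inEdges v).val.map w).filter (· ≠ 0)

open Classical in
-- Counting each nonzero value by an integer sum makes balance additive, so a relabelling can be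
-- handled as a correction term.
theorem balanced_iff_sum {w : E → ℂ} :
    G.Balanced w ↔ ∀ (v : V) (a : ℂ), a ≠ 0 →
      ∑ x ∈ G.outEdges v, (if w x = a then (1 : ℤ) else 0) =
        ∑ x ∈ G.inEdges v, (if w x = a then (1 : ℤ) else 0) := by
  have key : ∀ (A : Finset E) (a : ℂ), a ≠ 0 →
      (((A.val.map w).filter (· ≠ 0)).count a : ℤ) =
        ∑ x ∈ A, (if w x = a then (1 : ℤ) else 0) := by
    intro A a ha
    rw [Multiset.count_filter_of_pos (p := (· ≠ 0)) ha, Multiset.count_map, Finset.sum_boole]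
    simp only [eq_comm]
    rfl
  refine forall_congr' fun v => ?_
  rw [Multiset.ext]
  refine ⟨fun h a ha => ?_, fun h a => ?_⟩
  · rw [← key _ a ha, ← key _ a ha, h a]
  · by_cases ha : a = 0
    · rw [Multiset.count_filter_of_neg (p := (· ≠ 0)) (not_not.2 ha),
        Multiset.count_filter_of_neg (p := (· ≠ 0)) (not_not.2 ha)]
    · have := h a ha
      rw [← key _ a ha, ← key _ a ha] at this
      exact_mod_cast this

theorem balanced_zero : G.Balanced (0 : E → ℂ) := by
  classical
  rw [balanced_iff_sum]
  intro v a ha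
  simp [ha.symm]

open Classical in
theorem IsDirectedCycle.sum_outEdges_eq {c : Cycle E} (hc : G.IsDirectedCycle c) (v : V) (k : ℤ) :
    ∑ x ∈ G.outEdges v, (if x ∈ c then k else 0) = ∑ x ∈ G.inEdges v, (if x ∈ c then k else 0) := by
  have hnd : c.toMultiset.Nodup := by
    have := hc.nodup
    induction c using Quotient.inductionOn with
    | h l => exact this
  have hmem : ∀ x, x ∈ c.toMultiset ↔ x ∈ c := by
    intro x
    induction c using Quotient.inductionOn with
    | h l => exact Iff.rfl
  have key : ∀ f : E → V, (c.toMultiset.map f).count v =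
      (((Finset.univ.filter (fun x => f x = v)).filter (· ∈ c)).card) := by
    intro f
    rw [Multiset.count_map, ← Finset.card_mk (nodup := hnd.filter _)]
    congr 1
    ext x
    simp [hmem, eq_comm, and_comm]
  rw [← Finset.sum_filter, ← Finset.sum_filter, Finset.sum_const, Finset.sum_const, outEdges,
    inEdges, ← key, ← key, hc.map_tgt_perm]

/-- A cycle leaves each vertex as often as it enters it, so changing its constant label corrects
both counts equally. The labels b and b' may be zero. -/
theorem Balanced.of_eq_off_cycle {w w' : E → ℂ} (hw : G.Balanced w) {c : Cycle E}
    (hc : G.IsDirectedCycle c) {b b' : ℂ} (hb : ∀ x ∈ c, w x = b) (hb' : ∀ x ∈ c, w' x = b')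
    (h : ∀ x, x ∉ c → w' x = w x) : G.Balanced w' := by
  classical
  rw [balanced_iff_sum] at hw ⊢
  intro v a ha
  have key : ∀ x, (if w' x = a then (1 : ℤ) else 0) = (if w x = a then (1 : ℤ) else 0) +
      if x ∈ c then (if b' = a then (1 : ℤ) else 0) - (if b = a then (1 : ℤ) else 0) else 0 := by
    intro x
    by_cases hx : x ∈ c
    · simp [hx, hb x hx, hb' x hx]
    · simp [hx, h x hx]
  simp only [key, Finset.sum_add_distrib]
  rw [hw v a ha, hc.sum_outEdges_eq]

theorem Balanced.exists_cycle {w : E → ℂ} (hw : G.Balanced w) {x : E} (hx : w x ≠ 0) :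
    ∃ c, G.IsDirectedCycle c ∧ ∀ y ∈ c, w y = w x := by
  obtain ⟨c, hc, h⟩ := exists_isDirectedCycle_of_forall_exists (G := G) (A := {y | w y = w x})
    ⟨x, rfl⟩ fun y hy => by
      have : w x ∈ ((G.outEdges (G.tgt y)).val.map w).filter (· ≠ 0) := by
        rw [hw, Multiset.mem_filter, Multiset.mem_map]
        exact ⟨⟨y, mem_inEdges.2 rfl, hy⟩, hx⟩
      rw [Multiset.mem_filter, Multiset.mem_map] at this
      obtain ⟨⟨z, hz, e⟩, -⟩ := this
      exact ⟨z, e, (mem_outEdges.1 hz).symm⟩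
  exact ⟨c, hc, h⟩

theorem Balanced.exists_packing {w : E → ℂ} (hw : G.Balanced w) :
    ∃ C : Finset (Cycle E), (∀ c ∈ C, G.IsDirectedCycle c) ∧
      (C : Set (Cycle E)).Pairwise EdgeDisjoint ∧ (∀ c ∈ C, ∀ x ∈ c, w x ≠ 0) ∧
      w ∈ cycleSpan (C : Set (Cycle E)) := by
  classical
  induction hn : (Finset.univ.filter fun x => w x ≠ 0).card using Nat.strong_induction_on
    generalizing w with
  | _ n ih =>
  by_cases h0 : w = 0
  · exact ⟨∅, by simp, by simp, by simp, h0 ▸ Submodule.zero_mem _⟩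
  obtain ⟨x, hx⟩ := Function.ne_iff.1 h0
  obtain ⟨c, hc, hcw⟩ := hw.exists_cycle hx
  set w' : E → ℂ := fun y => if y ∈ c then 0 else w y with hw'
  have hbal : G.Balanced w' :=
    hw.of_eq_off_cycle hc hcw (b' := 0) (fun y hy => by simp [hw', hy]) fun y hy => by simp [hw', hy]
  have hlt : (Finset.univ.filter fun x => w' x ≠ 0).card < n := by
    rw [← hn]
    apply Finset.card_lt_card
    obtain ⟨y, hy⟩ := Cycle.exists_mem_of_ne_nil hc.1
    rw [Finset.ssubset_iff_of_subset]
    · exact ⟨y, by simpa [hcw y hy] using hx, by simp [hw', hy]⟩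
    · intro z
      simp [hw']
  obtain ⟨C, hC, hdisj, hsupp, hmem⟩ := ih _ hlt hbal rfl
  -- This is where the support clause of the induction is needed: the packing avoids c because w'
  -- vanishes there.
  have hoff : ∀ d ∈ C, ∀ y ∈ d, y ∉ c := fun d hd y hy hyc => hsupp d hd y hy (by simp [hw', hyc])
  refine ⟨insert c C, ?_, ?_, ?_, ?_⟩
  · simpa using ⟨hc, hC⟩
  · rw [Finset.coe_insert, Set.pairwise_insert]
    exact ⟨hdisj, fun d hd _ => ⟨fun y hy hyd => hoff d hd y hyd hy, hoff d hd⟩⟩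
  · simp only [Finset.mem_insert, forall_eq_or_imp]
    refine ⟨fun y hy => by simpa [hcw y hy] using hx, fun d hd y hy => ?_⟩
    have := hsupp d hd y hy
    simpa [hw', hoff d hd y hy] using this
  · have : w = w x • cycleVec c + w' := by
      ext y
      by_cases hy : y ∈ c
      · simp [hw', hy, cycleVec, hcw y hy]
      · simp [hw', hy, cycleVec]
    rw [this]
    exact Submodule.add_mem _ (Submodule.smul_mem _ _ (cycleVec_mem_cycleSpan (by simp)))
      (cycleSpan_mono (by simp) hmem)

/-- Cycles are added one at a time; by disjointness the new one changes its constant label from 0 to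
its coefficient. -/
theorem balanced_of_mem_cycleSpan {C : Finset (Cycle E)} (hC : ∀ c ∈ C, G.IsDirectedCycle c)
    (hdisj : (C : Set (Cycle E)).Pairwise EdgeDisjoint) {w : E → ℂ}
    (hw : w ∈ cycleSpan (C : Set (Cycle E))) : G.Balanced w := by
  classical
  induction C using Finset.induction_on generalizing w with
  | empty =>
    have : w = 0 := by simpa [cycleSpan] using hw
    exact this ▸ balanced_zero
  | insert c C hcC ih =>
    rw [Finset.coe_insert, cycleSpan, Set.image_insert_eq, Submodule.mem_span_insert] at hw
    obtain ⟨a, z, hz, rfl⟩ := hw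
    rw [Finset.coe_insert] at hdisj
    have hbal := ih (fun d hd => hC d (by simp [hd])) (hdisj.mono (by simp)) hz
    have hz0 : ∀ x ∈ c, z x = 0 := by
      intro x hx
      by_contra hne
      obtain ⟨d, hd, hxd⟩ := exists_mem_of_mem_cycleSpan hz hne
      have hcd : c ≠ d := by
        rintro rfl
        exact hcC hd
      exact hdisj (by simp) (Or.inr hd) hcd x hx hxd
    refine hbal.of_eq_off_cycle (hC c (by simp)) hz0 (b' := a) (fun x hx => ?_) fun x hx => ?_
    · simp [cycleVec_of_mem hx, hz0 x hx]
    · simp [cycleVec_of_notMem hx]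

theorem balanced_iff_exists_packing {w : E → ℂ} :
    G.Balanced w ↔ ∃ C : Finset (Cycle E), (∀ c ∈ C, G.IsDirectedCycle c) ∧
      (C : Set (Cycle E)).Pairwise EdgeDisjoint ∧ w ∈ cycleSpan (C : Set (Cycle E)) := by
  constructor
  · intro h
    obtain ⟨C, hC, hd, -, hw⟩ := h.exists_packing
    exact ⟨C, hC, hd, hw⟩
  · rintro ⟨C, hC, hd, hw⟩
    exact balanced_of_mem_cycleSpan hC hd hw

/-- A balanced labelling with at most one nonzero label on the edges leaving each vertex. -/
def StronglyBalanced (G : DiMultigraph V E) (w : E → ℂ) : Prop :=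
  G.Balanced w ∧ ∀ v, Multiset.card (((G.outEdges v).val.map w).filter (· ≠ 0)) ≤ 1

theorem stronglyBalanced_iff {w : E → ℂ} :
    G.StronglyBalanced w ↔
      G.Balanced w ∧ ∀ x y, w x ≠ 0 → w y ≠ 0 → G.src x = G.src y → x = y := by
  classical
  refine and_congr_right fun _ => ?_
  have : ∀ v, Multiset.card (((G.outEdges v).val.map w).filter (· ≠ 0)) =
      ((G.outEdges v).filter fun x => w x ≠ 0).card := by
    intro v
    rw [Multiset.filter_map, Multiset.card_map]
    rfl
  simp only [this, Finset.card_le_one, Finset.mem_filter, mem_outEdges]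
  constructor
  · intro h x y hx hy e
    exact h _ x ⟨rfl, hx⟩ y ⟨e.symm, hy⟩
  · rintro h v x ⟨rfl, hx⟩ y ⟨e, hy⟩
    exact h x y hx hy e.symm

theorem stronglyBalanced_iff_exists_packing {w : E → ℂ} :
    G.StronglyBalanced w ↔ ∃ C : Finset (Cycle E), (∀ c ∈ C, G.IsDirectedCycle c) ∧
      (C : Set (Cycle E)).Pairwise G.VertexDisjoint ∧ w ∈ cycleSpan (C : Set (Cycle E)) := by
  rw [stronglyBalanced_iff]
  constructor
  · rintro ⟨h, hs⟩
    obtain ⟨C, hC, hd, h0, hw⟩ := h.exists_packing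
    refine ⟨C, hC, fun c hc d hd' hne v hv hv' => ?_, hw⟩
    obtain ⟨x, hx, rfl⟩ := Cycle.mem_map.1 hv
    obtain ⟨y, hy, e⟩ := Cycle.mem_map.1 hv'
    obtain rfl := hs x y (h0 c hc x hx) (h0 d hd' y hy) e.symm
    exact hd hc hd' hne x hx hy
  · rintro ⟨C, hC, hd, hw⟩
    refine ⟨balanced_of_mem_cycleSpan hC (hd.imp fun _ _ h => h.edgeDisjoint) hw,
      fun x y hx hy e => ?_⟩
    obtain ⟨c, hc, hxc⟩ := exists_mem_of_mem_cycleSpan hw hx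
    obtain ⟨d, hd', hyd⟩ := exists_mem_of_mem_cycleSpan hw hy
    by_cases hcd : c = d
    · subst hcd
      exact (hC c hc).src_injOn hxc hyd e
    · exact absurd (Cycle.mem_map.2 ⟨y, hyd, e.symm⟩)
        (hd hc hd' hcd (G.src x) (Cycle.mem_map.2 ⟨x, hxc, rfl⟩))

end DiMultigraph

namespace DiMultigraph

variable {V E : Type*} {G : DiMultigraph V E}

/-! ### Unions of spans of cycle packings -/

section Packing

variable [Finite E] {R : Cycle E → Cycle E → Prop} {Z : Set (ℙ ℂ (E → ℂ))}

/-- `Z` is the union of the projectivized spans of the packings of cycles disjoint in the sense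
of `R`. -/
def IsPackingUnion (G : DiMultigraph V E) (R : Cycle E → Cycle E → Prop)
    (Z : Set (ℙ ℂ (E → ℂ))) : Prop :=
  ∀ (w : E → ℂ) (hw : w ≠ 0), Projectivization.mk ℂ w hw ∈ Z ↔
    ∃ C : Finset (Cycle E), (∀ c ∈ C, G.IsDirectedCycle c) ∧
      (C : Set (Cycle E)).Pairwise R ∧ w ∈ cycleSpan (C : Set (Cycle E))

theorem IsPackingUnion.eq_projectivization (hZ : G.IsPackingUnion R Z)
    (h : G.directedCycles.Pairwise R) :
    Z = ((cycleSpan G.directedCycles).projectivization : Set (ℙ ℂ (E → ℂ))) := by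
  ext p
  induction p using Projectivization.ind with | h w hw
  rw [hZ, SetLike.mem_coe, Submodule.mk_mem_projectivization_iff]
  constructor
  · rintro ⟨C, hC, -, hwC⟩
    exact cycleSpan_mono hC hwC
  · intro hw
    exact ⟨G.finite_directedCycles.toFinset, fun c hc => G.finite_directedCycles.mem_toFinset.1 hc,
      by simpa using h,
      by simpa using hw⟩

theorem IsPackingUnion.pairwise_of_isProjVariety (hZ : G.IsPackingUnion R Z)
    (hR : ∀ c d, R c d → EdgeDisjoint c d) (h : IsProjVariety Z) :
    G.directedCycles.Pairwise R := by
  classical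
  set s : Finset (Finset (Cycle E)) := G.finite_directedCycles.toFinset.powerset.filter
    fun C => (C : Set (Cycle E)).Pairwise R with hs
  have hmem : ∀ C, C ∈ s ↔ (∀ c ∈ C, G.IsDirectedCycle c) ∧ (C : Set (Cycle E)).Pairwise R := by
    intro C
    rw [hs, Finset.mem_filter, Finset.mem_powerset]
    refine and_congr_left fun _ => forall₂_congr fun c _ => ?_
    simp [directedCycles]
  -- Only finitely many packings exist, and the empty one makes the index set nonempty.
  obtain ⟨C, hCs, hC⟩ := h.exists_eq_of_eq_biUnion s
    (Y := fun C => ((cycleSpan (C : Set (Cycle E))).projectivization : Set (ℙ ℂ (E → ℂ))))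
    (fun C _ => isProjAlgebraicSet_projectivization _) (by
      ext p
      induction p using Projectivization.ind with | h w hw
      rw [hZ]
      simp only [Set.mem_iUnion, SetLike.mem_coe, Submodule.mk_mem_projectivization_iff, hmem,
        exists_prop, and_assoc]) ⟨∅, by simp [hmem]⟩
  obtain ⟨hCcyc, hCR⟩ := (hmem C).1 hCs
  refine hCR.mono fun c (hc : G.IsDirectedCycle c) => ?_
  have hcZ : Projectivization.mk ℂ (cycleVec c) hc.cycleVec_ne_zero ∈ Z :=
    (hZ _ _).2 ⟨{c}, by simpa using hc, by simp, cycleVec_mem_cycleSpan (by simp)⟩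
  rw [hC, SetLike.mem_coe, Submodule.mk_mem_projectivization_iff] at hcZ
  obtain ⟨x, hx⟩ := Cycle.exists_mem_of_ne_nil hc.1
  obtain ⟨d, hd, hxd⟩ := exists_mem_of_mem_cycleSpan hcZ (x := x) (by simp [cycleVec_of_mem hx])
  -- Vectors in the span are constant along d, and the indicator of c is 1 at x, so d lies inside c.
  have hdc : d = c := by
    refine (hCcyc d hd).eq_of_subset hc fun y hy => ?_
    by_contra hyc
    have := eq_of_mem_cycleSpan (hCR.imp hR) hcZ hd hxd hy
    rw [cycleVec_of_mem hx, cycleVec_of_notMem hyc] at this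
    exact one_ne_zero this
  exact hdc ▸ hd

/-- A maximum packing is a subset of the finite set of all cycles, so equal size means equality. -/
theorem encard_directedCycles_eq_iff {a : ℕ}
    (ha : IsGreatest {n | ∃ C : Finset (Cycle E), (∀ c ∈ C, G.IsDirectedCycle c) ∧
      (C : Set (Cycle E)).Pairwise R ∧ C.card = n} a) :
    G.directedCycles.encard = (a : ℕ∞) ↔ G.directedCycles.Pairwise R := by
  obtain ⟨⟨C, hC, hCR, rfl⟩, hmax⟩ := ha
  rw [← Set.encard_coe_eq_coe_finsetCard]
  constructor
  · intro h
    have e : (C : Set (Cycle E)) = G.directedCycles :=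
      C.finite_toSet.eq_of_subset_of_encard_le hC h.le
    exact e ▸ hCR
  · intro h
    refine le_antisymm ?_ (Set.encard_le_encard hC)
    have := hmax ⟨G.finite_directedCycles.toFinset, fun c hc => G.finite_directedCycles.mem_toFinset.1 hc,
      by simpa using h,
      rfl⟩
    rw [G.finite_directedCycles.encard_eq_coe_toFinset_card, Set.encard_coe_eq_coe_finsetCard]
    exact_mod_cast this

theorem IsPackingUnion.tfae (hZ : G.IsPackingUnion R Z) (hR : ∀ c d, R c d → EdgeDisjoint c d)
    {a : ℕ} (ha : IsGreatest {n | ∃ C : Finset (Cycle E), (∀ c ∈ C, G.IsDirectedCycle c) ∧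
      (C : Set (Cycle E)).Pairwise R ∧ C.card = n} a) :
    List.TFAE [IsProjVariety Z, IsProjLinearSubspace Z, G.directedCycles.encard = (a : ℕ∞)] := by
  rw [encard_directedCycles_eq_iff ha]
  tfae_have 1 → 3 := hZ.pairwise_of_isProjVariety hR
  tfae_have 3 → 2 := fun h => ⟨_, (hZ.eq_projectivization h).symm⟩
  tfae_have 2 → 1 := fun h => h.isProjVariety
  tfae_finish

end Packing

/-! ### The incidence sets -/

theorem aeval_edgeESymm (w : E → ℂ) (A : Finset E) (l : ℕ) :
    MvPolynomial.aeval w (edgeESymm A l) = (A.val.map w).esymm l := by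
  simp only [edgeESymm, Multiset.esymm, map_multiset_sum, Multiset.powersetCard_map,
    Multiset.map_map]
  congr 2
  ext s
  simp [map_multiset_prod]

/-- Scaling invariance of `p` stands in for homogeneity of the ideal's elements; for each
representative, the kernel of evaluation is an ideal containing the generators. -/
theorem mk_mem_projZeroLocus_span {S : Set (MvPolynomial E ℤ)} {p : (E → ℂ) → Prop}
    (hp : ∀ w, p w ↔ ∀ f ∈ S, MvPolynomial.aeval w f = 0)
    (hsmul : ∀ (a : ℂ) w, p w → p (a • w)) {w : E → ℂ} (hw : w ≠ 0) :
    Projectivization.mk ℂ w hw ∈ projZeroLocus (Ideal.span S : Set (MvPolynomial E ℤ)) ↔ p w := by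
  constructor
  · intro h
    exact (hp w).2 fun f hf => h f (Ideal.subset_span hf) w hw rfl
  · intro h f hf u hu e
    obtain ⟨a, rfl⟩ := (Projectivization.mk_eq_mk_iff' ℂ _ _ hu hw).1 e
    have hle : Ideal.span S ≤ RingHom.ker (MvPolynomial.aeval (R := ℤ) (a • w)) :=
      Ideal.span_le.2 ((hp _).1 (hsmul a w h))
    exact hle hf

variable [Fintype E]

theorem balanced_iff_aeval (w : E → ℂ) :
    G.Balanced w ↔ ∀ f ∈ {f : MvPolynomial E ℤ | ∃ (v : V) (l : ℕ), 1 ≤ l ∧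
      l ≤ max (G.outEdges v).card (G.inEdges v).card ∧
      f = edgeESymm (G.outEdges v) l - edgeESymm (G.inEdges v) l}, MvPolynomial.aeval w f = 0 := by
  simp only [Balanced, Multiset.filter_ne_zero_eq_iff_esymm_of_le_max, Multiset.card_map,
    Finset.card_val]
  constructor
  · rintro h f ⟨v, l, h1, h2, rfl⟩
    rw [map_sub, aeval_edgeESymm, aeval_edgeESymm, h v l h1 h2, sub_self]
  · intro h v l h1 h2
    have := h _ ⟨v, l, h1, h2, rfl⟩
    rwa [map_sub, aeval_edgeESymm, aeval_edgeESymm, sub_eq_zero] at this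

theorem stronglyBalanced_iff_aeval (w : E → ℂ) :
    G.StronglyBalanced w ↔ ∀ f ∈
      ({f | ∃ v : V, f = edgeESymm (G.outEdges v) 1 - edgeESymm (G.inEdges v) 1} ∪
      {f | ∃ (v : V) (l : ℕ), 2 ≤ l ∧ l ≤ (G.outEdges v).card ∧ f = edgeESymm (G.outEdges v) l} ∪
      {f | ∃ (v : V) (l : ℕ), 2 ≤ l ∧ l ≤ (G.inEdges v).card ∧ f = edgeESymm (G.inEdges v) l} :
        Set (MvPolynomial E ℤ)), MvPolynomial.aeval w f = 0 := by
  simp only [StronglyBalanced, Balanced, ← forall_and, Multiset.strong_iff_esymm,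
    Multiset.card_map, Finset.card_val]
  constructor
  · rintro h f ((⟨v, rfl⟩ | ⟨v, l, h1, h2, rfl⟩) | ⟨v, l, h1, h2, rfl⟩)
    · rw [map_sub, aeval_edgeESymm, aeval_edgeESymm, (h v).1, sub_self]
    · rw [aeval_edgeESymm, ((h v).2 l h1).1 h2]
    · rw [aeval_edgeESymm, ((h v).2 l h1).2 h2]
  · intro h v
    refine ⟨?_, fun l h1 => ⟨fun h2 => ?_, fun h2 => ?_⟩⟩
    · have := h _ (Or.inl (Or.inl ⟨v, rfl⟩))
      rwa [map_sub, aeval_edgeESymm, aeval_edgeESymm, sub_eq_zero] at this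
    · rw [← aeval_edgeESymm]
      exact h _ (Or.inl (Or.inr ⟨v, l, h1, h2, rfl⟩))
    · rw [← aeval_edgeESymm]
      exact h _ (Or.inr ⟨v, l, h1, h2, rfl⟩)

theorem isPackingUnion_incidenceSet (G : DiMultigraph V E) :
    G.IsPackingUnion EdgeDisjoint G.incidenceSet := by
  intro w hw
  rw [← balanced_iff_exists_packing]
  refine mk_mem_projZeroLocus_span balanced_iff_aeval (fun a u hu => ?_) hw
  rw [balanced_iff_exists_packing] at hu ⊢
  obtain ⟨C, hC, hd, h⟩ := hu
  exact ⟨C, hC, hd, Submodule.smul_mem _ a h⟩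

theorem isPackingUnion_strongIncidenceSet (G : DiMultigraph V E) :
    G.IsPackingUnion G.VertexDisjoint G.strongIncidenceSet := by
  intro w hw
  rw [← stronglyBalanced_iff_exists_packing]
  refine mk_mem_projZeroLocus_span stronglyBalanced_iff_aeval (fun a u hu => ?_) hw
  rw [stronglyBalanced_iff_exists_packing] at hu ⊢
  obtain ⟨C, hC, hd, h⟩ := hu
  exact ⟨C, hC, hd, Submodule.smul_mem _ a h⟩

end DiMultigraph

theorem mainTheorem4 {V E : Type*} [Fintype V] [Fintype E] (G : DiMultigraph V E) :
    List.TFAE [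
      IsProjVariety G.incidenceSet,
      IsProjLinearSubspace G.incidenceSet,
      G.directedCycles.encard = (G.alpha : ℕ∞)] ∧
    List.TFAE [
      IsProjVariety G.strongIncidenceSet,
      IsProjLinearSubspace G.strongIncidenceSet,
      G.directedCycles.encard = (G.strongAlpha : ℕ∞)] ∧
    (IsProjVariety G.strongIncidenceSet → G.incidenceSet = G.strongIncidenceSet) := by
  have hP := G.isPackingUnion_incidenceSet
  have hS := G.isPackingUnion_strongIncidenceSet
  have hR : ∀ c d, G.VertexDisjoint c d → DiMultigraph.EdgeDisjoint c d :=
    fun _ _ h => h.edgeDisjoint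
  refine ⟨hP.tfae (fun _ _ h => h) G.isGreatest_alpha, hS.tfae hR G.isGreatest_strongAlpha,
    fun h => ?_⟩
  have hV := hS.pairwise_of_isProjVariety hR h
  rw [hP.eq_projectivization (hV.imp hR), hS.eq_projectivization hV]
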